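/- All graphs are finite and simple. A signed graph $\Gamma=(G,\sigma)$ consists of a graph $G$ (the underlying graph) and a sign function $\sigma:E(G)\to\{-1,+1\}$. The net-degree of a vertex is the number of its neighbours along positive edges minus the number of its neighbours along negative edges. The net Laplacian matrix is $L^{\pm}(\Gamma)=D^{\pm}(\Gamma)-A(\Gamma)$, where $D^{\pm}(\Gamma)$ is the diagonal matrix of net-degrees and $A(\Gamma)$ is the signed adjacency matrix, whose $(u,v)$ entry is $\sigma(uv)$ if $uv\in E(G)$ and $0$ otherwise. Let $\eta(\Gamma)$ denote the nullity of $L^{\pm}(\Gamma)$, i.e. the multiplicity of $0$ as an eigenvalue of $L^{\pm}(\Gamma)$, and let $-\Gamma$ be obtained from $\Gamma$ by reversing the sign of every edge. Let $K_m$ denote the complete graph on $m$ vertices with all edges positive, and let $K_m\triangledown^{-}K_m$ denote the signed graph obtained from two disjoint copies of $K_m$ by adding all possible edges between them, all with negative sign. A cactus graph is a connected graph in which any two distinct cycles have no edge in common; a signed cactus graph is a signed graph whose underlying graph is a cactus graph. For a cycle $C$, let $m^{+}(C)$ and $m^{-}(C)$ be the numbers of its positive and negative edges. **Theorem.** Let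 $\Gamma$ be a connected signed graph of order $n\ge 2$ with cyclomatic number $\beta(\Gamma)=|E(\Gamma)|-|V(\Gamma)|+1$. Then (i) $1\le\eta(\Gamma)\le\min\{\beta(\Gamma)+1,\,n-1\}$; (ii) $\eta(\Gamma)=n-1$ if and only if $n$ is even and $\Gamma$ is isomorphic, as a signed graph, to $K_{n/2}\triangledown^{-}K_{n/2}$ or to $-(K_{n/2}\triangledown^{-}K_{n/2})$. Moreover, if $\Gamma$ is a signed cactus graph, then (iii) $\eta(\Gamma)=1$ if and only if $m^{+}(C)\ne m^{-}(C)$ for every cycle $C$ of $\Gamma$; (iv) $\eta(\Gamma)=\beta(\Gamma)+1$ if and only if $m^{+}(C)=m^{-}(C)$ for every cycle $C$ of $\Gamma$. -/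

import Mathlib

/-- A signed graph on the vertex set `V`: a simple graph together with a sign in `{-1, 1}`
for each of its edges. -/
structure SignedGraph (V : Type*) where
  /-- The underlying graph. -/
  graph : SimpleGraph V
  /-- The sign function on the edges of the underlying graph. -/
  sign : graph.edgeSet → ℤˣ

namespace SignedGraph

variable {V W : Type*}

/-- The graph consisting of the edges of sign `ε`. -/
def signGraph (Γ : SignedGraph V) (ε : ℤˣ) : SimpleGraph V where
  Adj v w := ∃ h : Γ.graph.Adj v w, Γ.sign ⟨s(v, w), h⟩ = ε
  symm := by
    constructor
    rintro v w ⟨h, hs⟩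
    refine ⟨h.symm, ?_⟩
    rw [← hs]
    congr 2
    exact Sym2.eq_swap
  loopless := ⟨fun v h => Γ.graph.irrefl h.1⟩

/-- The graph consisting of the positive edges. -/
def posGraph (Γ : SignedGraph V) : SimpleGraph V := Γ.signGraph 1

/-- The graph consisting of the negative edges. -/
def negGraph (Γ : SignedGraph V) : SimpleGraph V := Γ.signGraph (-1)

/-- The net-degree of a vertex: the number of its positive neighbours minus the number of its
negative neighbours. -/
noncomputable def netDegree (Γ : SignedGraph V) (v : V) : ℤ :=
  ((Γ.posGraph.neighborSet v).ncard : ℤ) - ((Γ.negGraph.neighborSet v).ncard : ℤ)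

open Classical in
/-- The adjacency matrix: the entry at `(v, w)` is the sign of the edge `vw`, and `0` if
`v` and `w` are not adjacent. -/
noncomputable def adjMatrix (Γ : SignedGraph V) : Matrix V V ℝ :=
  Matrix.of fun v w =>
    if h : Γ.graph.Adj v w then (((Γ.sign ⟨s(v, w), h⟩ : ℤˣ) : ℤ) : ℝ) else 0

/-- The net Laplacian matrix: the diagonal matrix of net-degrees minus the adjacency matrix. -/
noncomputable def netLaplacian [DecidableEq V] (Γ : SignedGraph V) : Matrix V V ℝ :=
  Matrix.diagonal (fun v => (Γ.netDegree v : ℝ)) - Γ.adjMatrix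

/-- The nullity of the net Laplacian matrix, that is, the dimension of its kernel. As the matrix
is real symmetric, this is the multiplicity of `0` as an eigenvalue. -/
noncomputable def nullity [Fintype V] [DecidableEq V] (Γ : SignedGraph V) : ℕ :=
  Module.finrank ℝ (LinearMap.ker (Matrix.toLin' Γ.netLaplacian))

/-- The cyclomatic number `|E| - |V| + 1` (of a connected signed graph). -/
noncomputable def cyclomaticNumber (Γ : SignedGraph V) : ℤ :=
  (Γ.graph.edgeSet.ncard : ℤ) - (Nat.card V : ℤ) + 1

/-- A subgraph is a cycle if it is traced out by a cyclic walk. -/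
def IsCycle {G : SimpleGraph V} (C : G.Subgraph) : Prop :=
  ∃ (v : V) (p : G.Walk v v), p.IsCycle ∧ p.toSubgraph = C

/-- A cactus graph: a connected graph in which any two (distinct) cycles have no common edge. -/
def IsCactus (G : SimpleGraph V) : Prop :=
  G.Connected ∧ ∀ C₁ C₂ : G.Subgraph, IsCycle C₁ → IsCycle C₂ → C₁ ≠ C₂ →
    Disjoint C₁.edgeSet C₂.edgeSet

/-- The number of positive edges of a subgraph. -/
noncomputable def numPos (Γ : SignedGraph V) (H : Γ.graph.Subgraph) : ℕ :=
  (H.edgeSet ∩ Γ.posGraph.edgeSet).ncard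

/-- The number of negative edges of a subgraph. -/
noncomputable def numNeg (Γ : SignedGraph V) (H : Γ.graph.Subgraph) : ℕ :=
  (H.edgeSet ∩ Γ.negGraph.edgeSet).ncard

/-- The complete graph with all edges positive. -/
def allPosComplete (V : Type*) : SignedGraph V where
  graph := ⊤
  sign := fun _ => 1

/-- The signed graph with the sign of every edge reversed. -/
def neg (Γ : SignedGraph V) : SignedGraph V where
  graph := Γ.graph
  sign := fun e => - Γ.sign e

open Classical in
/-- The negative join: the disjoint union of two signed graphs, together with all possible
negative edges between the two vertex sets. So its positive edges are
exactly the positive edges of the two parts. -/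
noncomputable def negJoin (Γ₁ : SignedGraph V) (Γ₂ : SignedGraph W) : SignedGraph (V ⊕ W) where
  graph := (Γ₁.graph ⊕g Γ₂.graph) ⊔ completeBipartiteGraph V W
  sign := fun e => if (e : Sym2 (V ⊕ W)) ∈ (Γ₁.posGraph ⊕g Γ₂.posGraph).edgeSet then 1 else -1

/-- Two signed graphs are isomorphic if there is an isomorphism of the underlying graphs that
preserves the signs of all edges. -/
def Isomorphic (Γ₁ : SignedGraph V) (Γ₂ : SignedGraph W) : Prop :=
  ∃ f : Γ₁.graph ≃g Γ₂.graph, ∀ e : Γ₁.graph.edgeSet, Γ₂.sign (f.mapEdgeSet e) = Γ₁.sign e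

end SignedGraph

/-!
Edge functions on the underlying graph `G` are antisymmetric functions of two vertices supported
on the edges. The net Laplacian is `x ↦ divergence (δ x)`, where the signed coboundary `δ x` takes
the value `σ(ab) (x a - x b)` on an edge `ab` (`toLin'_netLaplacian`). Hence `δ` maps the kernel of
the net Laplacian into the cycle space `Z` of `G`, the edge functions of zero divergence.

Weighting each edge by its sign gives a symmetric bilinear form on edge functions, the sign form.
The flows in `Z` of the form `δ x` are exactly the radical of the sign form on `Z`: the two signs
cancel in the pairing of `δ x` with a flow, and an edge function orthogonal to `Z` is a potential
difference (`map_signedCoboundary_ker`). As `G` is connected, the kernel of `δ` consists of the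
constants, so the nullity is `1` plus the dimension of the radical
(`nullity_eq_finrank_cycleRadical_add_one`). Since `dim Z` is the cyclomatic number, this gives the
bounds `1 ≤ η ≤ β + 1`, with `η = 1` when the form is nondegenerate on `Z`, and `η = β + 1` when it
vanishes on `Z`.

The cycle space is spanned by the flows of cycles (`cycleSpace_le_span`). In a cactus, distinct
cycles have disjoint supports, so these flows are orthogonal for the sign form, and the value of the
form on the flow of `C` is `2 (m⁺(C) - m⁻(C))` (`exists_orthogonal_cycle_flows`). Being diagonal,
the form is nondegenerate when all these values are nonzero, and zero when they all vanish.

The nullity is `n - 1` exactly when the net Laplacian has rank one. In that case it is `± s sᵀ` for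
a `±1` labelling `s` of the vertices with total `0` (`exists_labelling_of_nullity`), and the
two classes of `s` are the two complete graphs of the negative join.
-/

namespace SimpleGraph

variable {V : Type*}

/-! ### Flows and the cycle space of a graph -/

/-- The space of real edge functions of a graph. An edge function is encoded, with no choice of
orientation, as an antisymmetric function of two vertices which vanishes on non-adjacent pairs. -/
def edgeSpace (G : SimpleGraph V) : Submodule ℝ (V → V → ℝ) where
  carrier := {z | (∀ a b, z b a = -z a b) ∧ ∀ a b, ¬G.Adj a b → z a b = 0}
  add_mem' := by
    rintro y z ⟨hy, hy'⟩ ⟨hz, hz'⟩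
    refine ⟨fun a b => ?_, fun a b h => ?_⟩
    · simp only [Pi.add_apply, hy a b, hz a b]; ring
    · simp [hy' a b h, hz' a b h]
  zero_mem' := ⟨fun _ _ => by simp, fun _ _ _ => rfl⟩
  smul_mem' := by
    rintro c z ⟨hz, hz'⟩
    refine ⟨fun a b => ?_, fun a b h => ?_⟩
    · simp [hz a b]
    · simp [hz' a b h]

/-- The net flow of an edge function out of each vertex. -/
def divergence [Fintype V] : (V → V → ℝ) →ₗ[ℝ] (V → ℝ) where
  toFun z a := ∑ b, z a b
  map_add' y z := by ext a; simp [Finset.sum_add_distrib]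
  map_smul' c z := by ext a; simp [Finset.mul_sum]

/-- The cycle space: the edge functions with zero divergence. -/
def cycleSpace [Fintype V] (G : SimpleGraph V) : Submodule ℝ (V → V → ℝ) :=
  G.edgeSpace ⊓ LinearMap.ker divergence

theorem mem_cycleSpace [Fintype V] {G : SimpleGraph V} {z : V → V → ℝ} :
    z ∈ G.cycleSpace ↔ z ∈ G.edgeSpace ∧ divergence z = 0 :=
  Iff.rfl

/-- Summation by parts: the coboundary of `x` is adjoint to the divergence. -/
theorem sum_sub_mul_eq [Fintype V] {G : SimpleGraph V} {z : V → V → ℝ} (hz : z ∈ G.edgeSpace)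
    (x : V → ℝ) :
    ∑ a, ∑ b, (x a - x b) * z a b = 2 * ∑ a, x a * divergence z a := by
  have h1 : ∑ a, ∑ b, x b * z a b = -∑ a, ∑ b, x a * z a b := by
    rw [Finset.sum_comm, ← Finset.sum_neg_distrib]
    refine Finset.sum_congr rfl fun a _ => ?_
    rw [← Finset.sum_neg_distrib]
    refine Finset.sum_congr rfl fun b _ => ?_
    rw [hz.1 a b]; ring
  simp only [sub_mul, Finset.sum_sub_distrib, h1]
  simp only [divergence, LinearMap.coe_mk, AddHom.coe_mk, Finset.mul_sum]
  simp only [← Finset.mul_sum]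
  ring

section DecidableEq

variable [DecidableEq V]

/-- The unit flow along the dart from `u` to `v`. -/
def dartFlow (u v : V) : V → V → ℝ := fun a b =>
  (if a = u ∧ b = v then 1 else 0) - (if a = v ∧ b = u then 1 else 0)

theorem dartFlow_mem {G : SimpleGraph V} {u v : V} (h : G.Adj u v) :
    dartFlow u v ∈ G.edgeSpace := by
  refine ⟨fun a b => ?_, fun a b hab => ?_⟩
  · simp only [dartFlow, and_comm (a := b = u), and_comm (a := b = v)]; ring
  · have h1 : ¬(a = u ∧ b = v) := by rintro ⟨rfl, rfl⟩; exact hab h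
    have h2 : ¬(a = v ∧ b = u) := by rintro ⟨rfl, rfl⟩; exact hab h.symm
    simp [dartFlow, h1, h2]

theorem divergence_dartFlow [Fintype V] (u v : V) :
    divergence (dartFlow u v) = Pi.single u 1 - Pi.single v 1 := by
  ext a
  simp only [divergence, dartFlow, LinearMap.coe_mk, AddHom.coe_mk, Finset.sum_sub_distrib,
    ite_and, Pi.sub_apply, Pi.single_apply]
  congr 1 <;> split_ifs <;> simp

/-- The flow of one unit along a walk: each dart of the walk is counted with multiplicity,
and negatively when traversed backwards. -/
def walkFlow {G : SimpleGraph V} : ∀ {u v : V}, G.Walk u v → V → V → ℝ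
  | _, _, .nil => 0
  | u, _, .cons (v := w) _ p => dartFlow u w + walkFlow p

theorem walkFlow_mem {G : SimpleGraph V} {u v : V} (p : G.Walk u v) :
    walkFlow p ∈ G.edgeSpace := by
  induction p with
  | nil => exact Submodule.zero_mem _
  | cons h p ih => exact Submodule.add_mem _ (dartFlow_mem h) ih

theorem divergence_walkFlow [Fintype V] {G : SimpleGraph V} {u v : V} (p : G.Walk u v) :
    divergence (walkFlow p) = Pi.single u 1 - Pi.single v 1 := by
  induction p with
  | nil => simp [walkFlow]
  | cons h p ih => rw [walkFlow, map_add, divergence_dartFlow, ih]; abel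

theorem walkFlow_mem_cycleSpace [Fintype V] {G : SimpleGraph V} {u : V} (p : G.Walk u u) :
    walkFlow p ∈ G.cycleSpace :=
  mem_cycleSpace.2 ⟨walkFlow_mem p, by rw [divergence_walkFlow, sub_self]⟩

theorem walkFlow_eq_zero {G : SimpleGraph V} {u v : V} (p : G.Walk u v) {a b : V}
    (h : s(a, b) ∉ p.edges) : walkFlow p a b = 0 := by
  induction p with
  | nil => rfl
  | @cons u w _ hd p ih =>
    rw [Walk.edges_cons, List.mem_cons, not_or, Sym2.eq_iff, not_or] at h
    simp [walkFlow, dartFlow, h.1.1, h.1.2, ih h.2]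

/-- A trail carries a flow of `1` or `-1` on each of its edges, as it traverses the edge once. -/
theorem walkFlow_mul_self {G : SimpleGraph V} {u v : V} (p : G.Walk u v) (hp : p.IsTrail) {a b : V}
    (h : s(a, b) ∈ p.edges) : walkFlow p a b * walkFlow p a b = 1 := by
  induction p with
  | nil => simp at h
  | @cons u w _ hd p ih =>
    rw [Walk.isTrail_cons] at hp
    rw [Walk.edges_cons, List.mem_cons] at h
    by_cases hab : s(a, b) = s(u, w)
    · have h0 : walkFlow p a b = 0 := walkFlow_eq_zero p (hab ▸ hp.2)
      have hne : u ≠ w := hd.ne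
      rcases Sym2.eq_iff.1 hab with ⟨rfl, rfl⟩ | ⟨rfl, rfl⟩
      · simp [walkFlow, dartFlow, h0, hne]
      · simp [walkFlow, dartFlow, h0, hne]
    · have h1 := ih hp.1 (h.resolve_left hab)
      rw [Sym2.eq_iff, not_or] at hab
      simp [walkFlow, dartFlow, hab.1, hab.2, h1]

end DecidableEq

/-! ### The dimension of the cycle space -/

theorem finrank_edgeSpace [Finite V] (G : SimpleGraph V) :
    Module.finrank ℝ G.edgeSpace = G.edgeSet.ncard := by
  classical
  have := Fintype.ofFinite V
  have hout : ∀ e : Sym2 V, s((Quot.out e).1, (Quot.out e).2) = e := fun e => Quot.out_eq e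
  -- Orient each edge by `Quot.out`, and read off the value in that direction.
  let f : G.edgeSpace →ₗ[ℝ] (G.edgeSet → ℝ) :=
    { toFun := fun z e => z.1 (Quot.out e.1).1 (Quot.out e.1).2
      map_add' := fun _ _ => rfl
      map_smul' := fun _ _ => rfl }
  have hinj : Function.Injective f := by
    rw [← LinearMap.ker_eq_bot, LinearMap.ker_eq_bot']
    rintro ⟨z, hz⟩ h
    ext a b
    by_cases hab : G.Adj a b
    · have h1 : z (Quot.out s(a, b)).1 (Quot.out s(a, b)).2 = 0 :=
        congrFun h ⟨s(a, b), hab⟩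
      rcases Sym2.eq_iff.1 (hout s(a, b)) with ⟨h2, h3⟩ | ⟨h2, h3⟩
      · rwa [h2, h3] at h1
      · rw [h2, h3, hz.1, neg_eq_zero] at h1
        exact h1
    · exact hz.2 a b hab
  have hsurj : Function.Surjective f := by
    intro g
    refine ⟨⟨fun a b => if h : G.Adj a b then
      (if (Quot.out s(a, b)).1 = a then g ⟨s(a, b), h⟩ else -g ⟨s(a, b), h⟩) else 0, ?_, ?_⟩, ?_⟩
    · intro a b
      by_cases hab : G.Adj a b
      · have hsw : s(b, a) = s(a, b) := Sym2.eq_swap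
        have hne : a ≠ b := hab.ne
        simp only [hab, hab.symm, dite_true, hsw]
        rcases Sym2.eq_iff.1 (hout s(a, b)) with ⟨h2, -⟩ | ⟨h2, -⟩
        · simp [h2, hne]
        · simp [h2, hne.symm]
      · have hba : ¬G.Adj b a := fun h => hab h.symm
        simp [hab, hba]
    · intro a b hab
      simp [hab]
    · ext ⟨e, he⟩
      have h1 : G.Adj (Quot.out e).1 (Quot.out e).2 := by
        rw [← mem_edgeSet, hout]; exact he
      simp [f, h1, hout]
  rw [(LinearEquiv.ofBijective f ⟨hinj, hsurj⟩).finrank_eq, Module.finrank_fintype_fun_eq_card,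
    Set.ncard_eq_toFinset_card', Set.toFinset_card]

/-- On a connected graph, every function of zero total is a divergence. -/
theorem map_divergence_edgeSpace [Fintype V] {G : SimpleGraph V} (hG : G.Connected) :
    G.edgeSpace.map divergence =
      LinearMap.ker (∑ v, LinearMap.proj v : (V → ℝ) →ₗ[ℝ] ℝ) := by
  classical
  apply le_antisymm
  · rintro _ ⟨z, hz, rfl⟩
    have h := sum_sub_mul_eq hz (fun _ => 1)
    simpa [eq_comm] using h
  · intro x hx
    obtain ⟨r⟩ := hG.nonempty
    have hx0 : ∑ v, x v = 0 := by simpa using hx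
    have hsum : x = ∑ v, x v • (Pi.single v 1 - Pi.single r 1 : V → ℝ) := by
      simp only [smul_sub, Finset.sum_sub_distrib, ← Finset.sum_smul, hx0, zero_smul, sub_zero]
      ext a
      simp [Pi.single_apply]
    rw [hsum]
    refine Submodule.sum_mem _ fun v _ => Submodule.smul_mem _ _ ?_
    obtain ⟨p⟩ := hG.preconnected v r
    exact ⟨walkFlow p, walkFlow_mem p, divergence_walkFlow p⟩

theorem finrank_cycleSpace_add_card [Fintype V] {G : SimpleGraph V} (hG : G.Connected) :
    Module.finrank ℝ G.cycleSpace + Fintype.card V = G.edgeSet.ncard + 1 := by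
  classical
  have h1 := LinearMap.finrank_range_add_finrank_ker (divergence.domRestrict G.edgeSpace)
  rw [LinearMap.range_domRestrict, LinearMap.ker_domRestrict, map_divergence_edgeSpace hG,
    ← Submodule.finrank_map_subtype_eq, Submodule.map_comap_subtype, finrank_edgeSpace] at h1
  have hne : (∑ v, LinearMap.proj v : (V → ℝ) →ₗ[ℝ] ℝ) ≠ 0 := by
    obtain ⟨r⟩ := hG.nonempty
    intro h
    have := LinearMap.congr_fun h (Pi.single r 1)
    simp at this
  have h2 := Module.Dual.finrank_ker_add_one_of_ne_zero hne
  rw [Module.finrank_fintype_fun_eq_card] at h2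
  change _ + Module.finrank ℝ G.cycleSpace = _ at h1
  omega

/-! ### Cycles span the cycle space -/

/-- The support of a flow of zero divergence has no bridge, since the flow across a cut is zero.
So each edge of the support lies on a cycle inside the support. -/
theorem exists_isCycle_of_mem_cycleSpace [Fintype V] {G : SimpleGraph V} {z : V → V → ℝ}
    (hz : z ∈ G.cycleSpace) {v w : V} (hvw : z v w ≠ 0) :
    ∃ (u : V) (p : G.Walk u u), p.IsCycle ∧ s(v, w) ∈ p.edges ∧
      ∀ a b, s(a, b) ∈ p.edges → z a b ≠ 0 := by
  classical
  obtain ⟨hz1, hz2⟩ := mem_cycleSpace.1 hz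
  let H : SimpleGraph V :=
    { Adj := fun a b => z a b ≠ 0
      symm := ⟨fun a b h => by rw [hz1.1 a b]; exact neg_ne_zero.2 h⟩
      loopless := ⟨fun a h => h (hz1.2 a a (G.irrefl))⟩ }
  have hHG : H ≤ G := fun a b h => by
    by_contra hab
    exact h (hz1.2 a b hab)
  have hreach : (H.deleteEdges {s(v, w)}).Reachable v w := by
    by_contra hcon
    let S : Set V := {u | (H.deleteEdges {s(v, w)}).Reachable v u}
    have hvS : v ∈ S := Reachable.refl v
    have hwS : w ∉ S := hcon
    have hne : v ≠ w := fun h => hwS (h ▸ hvS)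
    have hcut : ∀ a b, a ∈ S → b ∉ S → z a b ≠ 0 → a = v ∧ b = w := by
      intro a b ha hb hab
      by_contra hnot
      have hs : s(a, b) ≠ s(v, w) := by
        intro h
        rcases Sym2.eq_iff.1 h with h | ⟨rfl, rfl⟩
        · exact hnot h
        · exact hwS ha
      apply hb
      refine Reachable.trans ha (Adj.reachable ?_)
      rw [deleteEdges_adj]
      exact ⟨hab, hs⟩
    have key := sum_sub_mul_eq hz1 (S.indicator 1)
    rw [hz2] at key
    have hterm : ∀ a b, ((S.indicator 1 a : ℝ) - S.indicator 1 b) * z a b =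
        z v w * ((if a = v ∧ b = w then 1 else 0) + if a = w ∧ b = v then 1 else 0) := by
      intro a b
      by_cases h1 : a = v ∧ b = w
      · obtain ⟨rfl, rfl⟩ := h1
        simp [hvS, hwS, hne]
      by_cases h2 : a = w ∧ b = v
      · obtain ⟨rfl, rfl⟩ := h2
        simp [hvS, hwS, hne.symm, hz1.1 b a]
      rw [if_neg h1, if_neg h2]
      simp only [add_zero, mul_zero]
      by_cases hab : z a b = 0
      · rw [hab, mul_zero]
      · by_cases ha : a ∈ S <;> by_cases hb : b ∈ S
        · simp [ha, hb]
        · exact absurd (hcut a b ha hb hab) h1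
        · refine absurd (hcut b a hb ha ?_) (fun h => h2 h.symm)
          rw [hz1.1 a b]; exact neg_ne_zero.2 hab
        · simp [ha, hb]
    simp only [hterm, ite_and] at key
    simp [← Finset.mul_sum, Finset.sum_add_distrib] at key
    exact hvw key
  obtain ⟨u, p, hp, he⟩ := adj_and_reachable_delete_edges_iff_exists_cycle.1
    (⟨hvw, hreach⟩ : H.Adj v w ∧ _)
  refine ⟨u, p.mapLe hHG, (Walk.isCycle_mapLe hHG).2 hp, ?_, fun a b hab => ?_⟩
  · rwa [Walk.edges_mapLe_eq_edges]
  · rw [Walk.edges_mapLe_eq_edges] at hab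
    exact p.adj_of_mem_edges hab

/-- A set of flows of zero divergence spans the cycle space as soon as every cycle is the support
of one of them. -/
theorem cycleSpace_le_span [Fintype V] {G : SimpleGraph V} {T : Set (V → V → ℝ)}
    (hT : T ⊆ G.cycleSpace)
    (hcyc : ∀ (u : V) (p : G.Walk u u), p.IsCycle →
      ∃ c ∈ T, ∀ a b, c a b ≠ 0 ↔ s(a, b) ∈ p.edges) :
    G.cycleSpace ≤ Submodule.span ℝ T := by
  classical
  -- Induction on the size of the support: a suitable multiple of the flow of a cycle inside the
  -- support cancels one value, and creates no new one.
  suffices h : ∀ (n : ℕ) (z : V → V → ℝ), z ∈ G.cycleSpace →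
      (Finset.univ.filter fun e : V × V => z e.1 e.2 ≠ 0).card = n → z ∈ Submodule.span ℝ T from
    fun z hz => h _ z hz rfl
  intro n
  induction n using Nat.strong_induction_on with
  | _ n ih =>
    intro z hz hn
    by_cases h0 : z = 0
    · rw [h0]; exact Submodule.zero_mem _
    obtain ⟨v, w, hvw⟩ : ∃ v w, z v w ≠ 0 := by
      by_contra! hcon
      exact h0 (funext fun a => funext fun b => hcon a b)
    obtain ⟨u, p, hp, he, hsub⟩ := exists_isCycle_of_mem_cycleSpace hz hvw
    obtain ⟨c, hcT, hc⟩ := hcyc u p hp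
    have hcvw : c v w ≠ 0 := (hc v w).2 he
    have hz' : z - (z v w / c v w) • c ∈ Submodule.span ℝ T := by
      refine ih _ ?_ _ (Submodule.sub_mem _ hz (Submodule.smul_mem _ _ (hT hcT))) rfl
      rw [← hn]
      refine Finset.card_lt_card ⟨fun e => ?_, fun hcon => ?_⟩
      · simp only [Finset.mem_filter, Finset.mem_univ, true_and, Pi.sub_apply, Pi.smul_apply,
          smul_eq_mul]
        intro hne hze
        by_cases hce : c e.1 e.2 = 0
        · exact hne (by rw [hze, hce]; ring)
        · exact hsub _ _ ((hc _ _).1 hce) hze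
      · have := @hcon (v, w) (by simpa using hvw)
        simp [div_mul_cancel₀ _ hcvw] at this
    have := Submodule.add_mem _ hz'
      (Submodule.smul_mem _ (z v w / c v w) (Submodule.subset_span hcT))
    rwa [sub_add_cancel] at this

/-! ### Potentials -/

/-- An edge function orthogonal to the cycle space is a potential difference. -/
theorem exists_potential [Fintype V] {G : SimpleGraph V} (hG : G.Connected)
    {y : V → V → ℝ} (hy : y ∈ G.edgeSpace)
    (horth : ∀ z ∈ G.cycleSpace, ∑ a, ∑ b, y a b * z a b = 0) :
    ∃ x : V → ℝ, ∀ a b, G.Adj a b → y a b = x a - x b := by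
  classical
  obtain ⟨r⟩ := hG.nonempty
  let p : ∀ v, G.Walk v r := fun v => (hG.preconnected v r).some
  let B : (V → V → ℝ) →ₗ[ℝ] ℝ :=
    { toFun := fun z => ∑ a, ∑ b, y a b * z a b
      map_add' := fun z z' => by simp [mul_add, Finset.sum_add_distrib]
      map_smul' := fun t z => by
        simp only [Pi.smul_apply, smul_eq_mul, Finset.mul_sum, RingHom.id_apply]
        refine Finset.sum_congr rfl fun a _ => Finset.sum_congr rfl fun b _ => ?_
        ring }
  -- The potential of `v` is the sum of `y` along a walk from `v` to the root.
  refine ⟨fun v => B (walkFlow (p v)) / 2, fun a b hab => ?_⟩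
  have hc : dartFlow a b + walkFlow (p b) - walkFlow (p a) ∈ G.cycleSpace := by
    refine mem_cycleSpace.2 ⟨Submodule.sub_mem _ (Submodule.add_mem _ (dartFlow_mem hab)
      (walkFlow_mem _)) (walkFlow_mem _), ?_⟩
    rw [map_sub, map_add, divergence_dartFlow, divergence_walkFlow, divergence_walkFlow]
    abel
  have h1 : B (dartFlow a b) = 2 * y a b := by
    have : B (dartFlow a b) = y a b - y b a := by
      simp [B, dartFlow, mul_sub, Finset.sum_sub_distrib, ite_and]
    rw [this, hy.1 a b]; ring
  have h2 : B (dartFlow a b + walkFlow (p b) - walkFlow (p a)) = 0 := horth _ hc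
  rw [map_sub, map_add, h1] at h2
  linarith

end SimpleGraph

namespace SignedGraph

open SimpleGraph

variable {V W : Type*}

/-! ### The net Laplacian as divergence of a signed coboundary -/

theorem adjMatrix_of_adj (Γ : SignedGraph V) {v w : V} (h : Γ.graph.Adj v w) :
    Γ.adjMatrix v w = ((Γ.sign ⟨s(v, w), h⟩ : ℤˣ) : ℤ) := by
  simp [adjMatrix, h]

theorem adjMatrix_of_not_adj (Γ : SignedGraph V) {v w : V} (h : ¬Γ.graph.Adj v w) :
    Γ.adjMatrix v w = 0 := by
  simp [adjMatrix, h]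

theorem adjMatrix_mul_self (Γ : SignedGraph V) {v w : V} (h : Γ.graph.Adj v w) :
    Γ.adjMatrix v w * Γ.adjMatrix v w = 1 := by
  rw [adjMatrix_of_adj Γ h]
  rcases Int.units_eq_one_or (Γ.sign ⟨s(v, w), h⟩) with h | h <;> simp [h]

theorem adjMatrix_ne_zero_iff (Γ : SignedGraph V) {v w : V} :
    Γ.adjMatrix v w ≠ 0 ↔ Γ.graph.Adj v w := by
  refine ⟨fun h => ?_, fun h h0 => ?_⟩
  · by_contra hcon
    exact h (Γ.adjMatrix_of_not_adj hcon)
  · simpa [h0] using Γ.adjMatrix_mul_self h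

open Classical in
theorem adjMatrix_eq_sub (Γ : SignedGraph V) (v w : V) :
    Γ.adjMatrix v w =
      (if Γ.posGraph.Adj v w then 1 else 0) - (if Γ.negGraph.Adj v w then 1 else 0) := by
  by_cases h : Γ.graph.Adj v w
  · rw [adjMatrix_of_adj Γ h]
    rcases Int.units_eq_one_or (Γ.sign ⟨s(v, w), h⟩) with h1 | h1 <;>
      simp [posGraph, negGraph, signGraph, h, h1, show (-1 : ℤˣ) ≠ 1 by decide,
        show (1 : ℤˣ) ≠ -1 by decide]
  · rw [adjMatrix_of_not_adj Γ h]
    simp [posGraph, negGraph, signGraph, h]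

theorem adjMatrix_symm (Γ : SignedGraph V) (v w : V) : Γ.adjMatrix w v = Γ.adjMatrix v w := by
  classical
  rw [adjMatrix_eq_sub, adjMatrix_eq_sub]
  congr 1 <;> exact if_congr (SimpleGraph.adj_comm _ _ _) rfl rfl

theorem netDegree_eq_sum [Fintype V] (Γ : SignedGraph V) (v : V) :
    (Γ.netDegree v : ℝ) = ∑ w, Γ.adjMatrix v w := by
  classical
  simp only [netDegree, adjMatrix_eq_sub, Finset.sum_sub_distrib, Finset.sum_boole]
  push_cast
  congr 3 <;> rw [Set.ncard_eq_toFinset_card'] <;> congr 1 <;> ext w <;> simp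

/-- The coboundary of a vertex function, weighted by the signs of the edges. -/
noncomputable def signedCoboundary (Γ : SignedGraph V) : (V → ℝ) →ₗ[ℝ] (V → V → ℝ) where
  toFun x a b := Γ.adjMatrix a b * (x a - x b)
  map_add' x y := by ext a b; simp; ring
  map_smul' c x := by ext a b; simp; ring

theorem signedCoboundary_apply (Γ : SignedGraph V) (x : V → ℝ) (a b : V) :
    Γ.signedCoboundary x a b = Γ.adjMatrix a b * (x a - x b) :=
  rfl

theorem signedCoboundary_mem (Γ : SignedGraph V) (x : V → ℝ) :
    Γ.signedCoboundary x ∈ Γ.graph.edgeSpace := by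
  refine ⟨fun a b => ?_, fun a b h => ?_⟩
  · rw [signedCoboundary_apply, signedCoboundary_apply, adjMatrix_symm]; ring
  · rw [signedCoboundary_apply, adjMatrix_of_not_adj Γ h, zero_mul]

theorem toLin'_netLaplacian [Fintype V] [DecidableEq V] (Γ : SignedGraph V) :
    Matrix.toLin' Γ.netLaplacian = divergence ∘ₗ Γ.signedCoboundary := by
  refine LinearMap.ext fun x => funext fun v => ?_
  simp only [Matrix.toLin'_apply, netLaplacian, Matrix.sub_mulVec, Pi.sub_apply,
    Matrix.mulVec_diagonal, netDegree_eq_sum, LinearMap.comp_apply, divergence, LinearMap.coe_mk,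
    AddHom.coe_mk, signedCoboundary_apply, mul_sub, Finset.sum_sub_distrib, ← Finset.sum_mul]
  rfl

theorem mem_ker_netLaplacian [Fintype V] [DecidableEq V] (Γ : SignedGraph V) {x : V → ℝ} :
    x ∈ LinearMap.ker (Matrix.toLin' Γ.netLaplacian) ↔
      Γ.signedCoboundary x ∈ Γ.graph.cycleSpace := by
  rw [toLin'_netLaplacian, LinearMap.mem_ker, LinearMap.comp_apply, mem_cycleSpace,
    and_iff_right (Γ.signedCoboundary_mem x)]

theorem finrank_ker_signedCoboundary (Γ : SignedGraph V)
    (hconn : Γ.graph.Connected) :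
    Module.finrank ℝ (LinearMap.ker Γ.signedCoboundary) = 1 := by
  have h : LinearMap.ker Γ.signedCoboundary = Submodule.span ℝ {1} := by
    ext x
    rw [Submodule.mem_span_singleton]
    constructor
    · intro hx
      have hadj : ∀ a b, Γ.graph.Adj a b → x a = x b := by
        intro a b hab
        have h1 : Γ.adjMatrix a b * (x a - x b) = 0 := congrFun (congrFun hx a) b
        exact sub_eq_zero.1 ((mul_eq_zero.1 h1).resolve_left (Γ.adjMatrix_ne_zero_iff.2 hab))
      have hwalk : ∀ a b, Γ.graph.Walk a b → x a = x b := by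
        intro a b p
        induction p with
        | nil => rfl
        | cons h p ih => rw [hadj _ _ h, ih]
      obtain ⟨r⟩ := hconn.nonempty
      refine ⟨x r, funext fun a => ?_⟩
      obtain ⟨p⟩ := hconn.preconnected r a
      simp [hwalk _ _ p]
    · rintro ⟨c, rfl⟩
      rw [LinearMap.mem_ker]
      ext a b
      simp [signedCoboundary_apply]
  have hne := hconn.nonempty
  rw [h, finrank_span_singleton (one_ne_zero)]

/-! ### The sign form on the cycle space -/

/-- The symmetric bilinear form on edge functions weighting each edge by its sign. Each edge
contributes twice, once in each direction. -/
noncomputable def signForm [Fintype V] (Γ : SignedGraph V) : LinearMap.BilinForm ℝ (V → V → ℝ) :=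
  LinearMap.mk₂ ℝ (fun y z => ∑ a, ∑ b, Γ.adjMatrix a b * y a b * z a b)
    (fun y y' z => by simp [mul_add, add_mul, Finset.sum_add_distrib])
    (fun c y z => by
      simp only [Pi.smul_apply, smul_eq_mul, Finset.mul_sum]
      refine Finset.sum_congr rfl fun a _ => Finset.sum_congr rfl fun b _ => ?_
      ring)
    (fun y z z' => by simp [mul_add, Finset.sum_add_distrib])
    (fun c y z => by
      simp only [Pi.smul_apply, smul_eq_mul, Finset.mul_sum]
      refine Finset.sum_congr rfl fun a _ => Finset.sum_congr rfl fun b _ => ?_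
      ring)

theorem signForm_apply [Fintype V] (Γ : SignedGraph V) (y z : V → V → ℝ) :
    Γ.signForm y z = ∑ a, ∑ b, Γ.adjMatrix a b * y a b * z a b :=
  rfl

/-- The radical of the sign form restricted to the cycle space. -/
noncomputable def cycleRadical [Fintype V] (Γ : SignedGraph V) : Submodule ℝ (V → V → ℝ) :=
  Γ.graph.cycleSpace ⊓ Γ.signForm.orthogonal Γ.graph.cycleSpace

theorem mem_cycleRadical [Fintype V] {Γ : SignedGraph V} {z : V → V → ℝ} :
    z ∈ Γ.cycleRadical ↔
      z ∈ Γ.graph.cycleSpace ∧ ∀ y ∈ Γ.graph.cycleSpace, Γ.signForm y z = 0 :=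
  Iff.rfl

/-- The signed coboundary is orthogonal to the cycle space for the sign form, the two signs
cancelling; conversely a radical element, with its signs removed, is a potential difference. -/
theorem map_signedCoboundary_ker [Fintype V] [DecidableEq V] (Γ : SignedGraph V)
    (hconn : Γ.graph.Connected) :
    (LinearMap.ker (Matrix.toLin' Γ.netLaplacian)).map Γ.signedCoboundary = Γ.cycleRadical := by
  have hsq : ∀ z ∈ Γ.graph.edgeSpace, ∀ a b, Γ.adjMatrix a b * (Γ.adjMatrix a b * z a b) =
      z a b := by
    intro z hz a b
    by_cases hab : Γ.graph.Adj a b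
    · rw [← mul_assoc, Γ.adjMatrix_mul_self hab, one_mul]
    · rw [hz.2 a b hab, mul_zero, mul_zero]
  apply le_antisymm
  · rintro _ ⟨x, hx, rfl⟩
    refine mem_cycleRadical.2 ⟨(mem_ker_netLaplacian Γ).1 hx, fun y hy => ?_⟩
    have h := sum_sub_mul_eq (mem_cycleSpace.1 hy).1 x
    rw [(mem_cycleSpace.1 hy).2] at h
    simp only [Pi.zero_apply, mul_zero, Finset.sum_const_zero] at h
    rw [signForm_apply, ← h]
    refine Finset.sum_congr rfl fun a _ => Finset.sum_congr rfl fun b _ => ?_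
    rw [signedCoboundary_apply]
    linear_combination (x a - x b) * hsq y (mem_cycleSpace.1 hy).1 a b
  · intro z hz
    obtain ⟨hz1, hz2⟩ := mem_cycleRadical.1 hz
    have hzE := (mem_cycleSpace.1 hz1).1
    obtain ⟨x, hx⟩ := exists_potential hconn (y := fun a b => Γ.adjMatrix a b * z a b)
      ⟨fun a b => by simp only [Γ.adjMatrix_symm a b, hzE.1 a b]; ring,
        fun a b hab => by simp [hzE.2 a b hab]⟩
      (fun y hy => by
        rw [← hz2 y hy, signForm_apply]
        refine Finset.sum_congr rfl fun a _ => Finset.sum_congr rfl fun b _ => ?_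
        ring)
    have hzx : Γ.signedCoboundary x = z := by
      ext a b
      rw [signedCoboundary_apply]
      by_cases hab : Γ.graph.Adj a b
      · rw [← hx a b hab, hsq z hzE]
      · rw [hzE.2 a b hab, Γ.adjMatrix_of_not_adj hab, zero_mul]
    exact ⟨x, (mem_ker_netLaplacian Γ).2 (hzx ▸ hz1), hzx⟩

theorem nullity_eq_finrank_cycleRadical_add_one [Fintype V] [DecidableEq V] (Γ : SignedGraph V)
    (hconn : Γ.graph.Connected) :
    Γ.nullity = Module.finrank ℝ Γ.cycleRadical + 1 := by
  have h := LinearMap.finrank_range_add_finrank_ker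
    (Γ.signedCoboundary.domRestrict (LinearMap.ker (Matrix.toLin' Γ.netLaplacian)))
  have hle : LinearMap.ker Γ.signedCoboundary ≤
      LinearMap.ker (Matrix.toLin' Γ.netLaplacian) := by
    rw [toLin'_netLaplacian]
    exact LinearMap.ker_le_ker_comp _ _
  rw [LinearMap.range_domRestrict, LinearMap.ker_domRestrict, map_signedCoboundary_ker Γ hconn,
    ← Submodule.finrank_map_subtype_eq, Submodule.map_comap_subtype, inf_eq_right.2 hle,
    finrank_ker_signedCoboundary Γ hconn] at h
  exact h.symm

theorem cyclomaticNumber_eq_finrank [Fintype V] (Γ : SignedGraph V) (hconn : Γ.graph.Connected) :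
    Γ.cyclomaticNumber = Module.finrank ℝ Γ.graph.cycleSpace := by
  have h := finrank_cycleSpace_add_card hconn
  rw [cyclomaticNumber, Nat.card_eq_fintype_card]
  omega

/-! ### Signed cactus graphs -/

theorem sum_sum_ite_adj [Fintype V] (G : SimpleGraph V) [DecidableRel G.Adj] :
    ∑ a, ∑ b, (if G.Adj a b then (1 : ℝ) else 0) = 2 * G.edgeSet.ncard := by
  classical
  have h := G.sum_degrees_eq_twice_card_edges
  rw [Set.ncard_eq_toFinset_card' G.edgeSet, Set.toFinset_card, ← SimpleGraph.edgeFinset_card]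
  rw [← @Nat.cast_inj ℝ] at h
  push_cast at h
  rw [← h]
  refine Finset.sum_congr rfl fun a _ => ?_
  rw [Finset.sum_boole, ← SimpleGraph.card_neighborFinset_eq_degree,
    SimpleGraph.neighborFinset_eq_filter]

/-- On the flow of a cycle, the sign form is twice the sum of the signs of the edges. -/
theorem signForm_self_eq [Fintype V] (Γ : SignedGraph V) (C : Γ.graph.Subgraph) {c : V → V → ℝ}
    (h1 : ∀ a b, s(a, b) ∈ C.edgeSet → c a b * c a b = 1)
    (h0 : ∀ a b, s(a, b) ∉ C.edgeSet → c a b = 0) :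
    Γ.signForm c c = 2 * ((Γ.numPos C : ℝ) - Γ.numNeg C) := by
  classical
  let P : SimpleGraph V := Γ.posGraph ⊓ C.spanningCoe
  let N : SimpleGraph V := Γ.negGraph ⊓ C.spanningCoe
  have hP : P.edgeSet = C.edgeSet ∩ Γ.posGraph.edgeSet := by
    rw [Set.inter_comm]; simp [P]
  have hN : N.edgeSet = C.edgeSet ∩ Γ.negGraph.edgeSet := by
    rw [Set.inter_comm]; simp [N]
  rw [numPos, numNeg, ← hP, ← hN, mul_sub, ← sum_sum_ite_adj P, ← sum_sum_ite_adj N,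
    signForm_apply]
  simp only [← Finset.sum_sub_distrib]
  refine Finset.sum_congr rfl fun a _ => Finset.sum_congr rfl fun b _ => ?_
  by_cases h : s(a, b) ∈ C.edgeSet
  · rw [mul_assoc, h1 a b h, mul_one, adjMatrix_eq_sub]
    rw [SimpleGraph.Subgraph.mem_edgeSet] at h
    simp [P, N, h]
  · rw [h0 a b h]
    rw [SimpleGraph.Subgraph.mem_edgeSet] at h
    simp [P, N, h]

/-- The flows of the cycles of a signed cactus span the cycle space, and diagonalize the
sign form on it, because distinct cycles have disjoint supports. -/
theorem exists_orthogonal_cycle_flows [Fintype V] (Γ : SignedGraph V)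
    (hcactus : IsCactus Γ.graph) :
    ∃ c : {C : Γ.graph.Subgraph // IsCycle C} → V → V → ℝ,
      (∀ C, c C ∈ Γ.graph.cycleSpace) ∧ (∀ C, c C ≠ 0) ∧
      Γ.graph.cycleSpace ≤ Submodule.span ℝ (Set.range c) ∧
      (∀ C D, C ≠ D → Γ.signForm (c C) (c D) = 0) ∧
      ∀ C, Γ.signForm (c C) (c C) = 2 * ((Γ.numPos C.1 : ℝ) - Γ.numNeg C.1) := by
  classical
  choose v p hp hpC using fun C : {C : Γ.graph.Subgraph // IsCycle C} => C.2
  have hmem : ∀ C e, e ∈ (p C).edges ↔ e ∈ C.1.edgeSet := by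
    intro C e
    rw [← Walk.mem_edges_toSubgraph, hpC]
  have h0 : ∀ C a b, s(a, b) ∉ C.1.edgeSet → walkFlow (p C) a b = 0 := fun C a b h =>
    walkFlow_eq_zero _ (by rwa [hmem])
  have h1 : ∀ C a b, s(a, b) ∈ C.1.edgeSet → walkFlow (p C) a b * walkFlow (p C) a b = 1 :=
    fun C a b h => walkFlow_mul_self _ (hp C).isTrail (by rwa [hmem])
  have hsupp : ∀ C a b, walkFlow (p C) a b ≠ 0 ↔ s(a, b) ∈ C.1.edgeSet := by
    refine fun C a b => ⟨fun h => ?_, fun h hz => ?_⟩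
    · by_contra hcon
      exact h (h0 C a b hcon)
    · simpa [hz] using h1 C a b h
  refine ⟨fun C => walkFlow (p C), fun C => walkFlow_mem_cycleSpace _, fun C hC => ?_, ?_, ?_,
    fun C => signForm_self_eq Γ C.1 (h1 C) (h0 C)⟩
  · obtain ⟨e, he⟩ := List.exists_mem_of_ne_nil _
      (fun h => (hp C).not_nil (Walk.edges_eq_nil.1 h))
    induction e with
    | _ a b =>
      exact (hsupp C a b).2 ((hmem C _).1 he) (congrFun (congrFun hC a) b)
  · refine cycleSpace_le_span ?_ fun u q hq => ?_
    · rintro _ ⟨C, rfl⟩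
      exact walkFlow_mem_cycleSpace _
    · refine ⟨_, ⟨⟨q.toSubgraph, u, q, hq, rfl⟩, rfl⟩, fun a b => ?_⟩
      rw [hsupp, Walk.mem_edges_toSubgraph]
  · intro C D hCD
    change Γ.signForm (walkFlow (p C)) (walkFlow (p D)) = 0
    have hdisj := hcactus.2 C.1 D.1 C.2 D.2 (fun h => hCD (Subtype.ext h))
    rw [signForm_apply]
    refine Finset.sum_eq_zero fun a _ => Finset.sum_eq_zero fun b _ => ?_
    by_cases h : s(a, b) ∈ C.1.edgeSet
    · rw [h0 D a b (Set.disjoint_left.1 hdisj h), mul_zero]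
    · rw [h0 C a b h, mul_zero, zero_mul]

theorem signForm_comm [Fintype V] (Γ : SignedGraph V) (y z : V → V → ℝ) :
    Γ.signForm y z = Γ.signForm z y := by
  rw [signForm_apply, signForm_apply]
  refine Finset.sum_congr rfl fun a _ => Finset.sum_congr rfl fun b _ => ?_
  ring

theorem cycleRadical_eq_bot_iff [Fintype V] (Γ : SignedGraph V) (hcactus : IsCactus Γ.graph) :
    Γ.cycleRadical = ⊥ ↔
      ∀ C : Γ.graph.Subgraph, IsCycle C → Γ.numPos C ≠ Γ.numNeg C := by
  classical
  obtain ⟨c, hc, hc0, hspan, horth, hself⟩ := Γ.exists_orthogonal_cycle_flows hcactus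
  have := Fintype.ofFinite {C : Γ.graph.Subgraph // IsCycle C}
  constructor
  · intro hbot C hC heq
    have hmem : c ⟨C, hC⟩ ∈ Γ.cycleRadical := by
      refine mem_cycleRadical.2 ⟨hc _, fun y hy => ?_⟩
      have hle : Submodule.span ℝ (Set.range c) ≤ LinearMap.ker (Γ.signForm (c ⟨C, hC⟩)) := by
        rw [Submodule.span_le]
        rintro _ ⟨D, rfl⟩
        rw [SetLike.mem_coe, LinearMap.mem_ker]
        by_cases hD : (⟨C, hC⟩ : {C : Γ.graph.Subgraph // IsCycle C}) = D
        · rw [← hD, hself, heq, sub_self, mul_zero]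
        · exact horth _ _ hD
      rw [signForm_comm]
      exact hle (hspan hy)
    rw [hbot, Submodule.mem_bot] at hmem
    exact hc0 _ hmem
  · intro h
    rw [eq_bot_iff]
    intro z hz
    obtain ⟨hz1, hz2⟩ := mem_cycleRadical.1 hz
    obtain ⟨a, rfl⟩ := (Submodule.mem_span_range_iff_exists_fun ℝ).1 (hspan hz1)
    refine Finset.sum_eq_zero fun C _ => ?_
    -- Pairing with the flow of `C` isolates the coefficient of `C`.
    have h2 := hz2 (c C) (hc C)
    rw [map_sum, Finset.sum_eq_single C (fun D _ hD => by
      rw [map_smul, horth C D (Ne.symm hD), smul_zero]) (fun hC => absurd (Finset.mem_univ C) hC),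
      map_smul, hself, smul_eq_mul] at h2
    have hne : (2 : ℝ) * ((Γ.numPos C.1 : ℝ) - Γ.numNeg C.1) ≠ 0 :=
      mul_ne_zero two_ne_zero (sub_ne_zero.2 (Nat.cast_injective.ne (h C.1 C.2)))
    rw [(mul_eq_zero.1 h2).resolve_right hne, zero_smul]

theorem cycleRadical_eq_cycleSpace_iff [Fintype V] (Γ : SignedGraph V)
    (hcactus : IsCactus Γ.graph) :
    Γ.cycleRadical = Γ.graph.cycleSpace ↔
      ∀ C : Γ.graph.Subgraph, IsCycle C → Γ.numPos C = Γ.numNeg C := by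
  obtain ⟨c, hc, -, hspan, horth, hself⟩ := Γ.exists_orthogonal_cycle_flows hcactus
  constructor
  · intro h C hC
    have h1 : c ⟨C, hC⟩ ∈ Γ.cycleRadical := h ▸ hc _
    have h2 := (mem_cycleRadical.1 h1).2 _ (hc ⟨C, hC⟩)
    rw [hself] at h2
    exact Nat.cast_injective (sub_eq_zero.1 ((mul_eq_zero.1 h2).resolve_left two_ne_zero))
  · intro h
    have hzero : ∀ C D, Γ.signForm (c C) (c D) = 0 := by
      intro C D
      by_cases hCD : C = D
      · rw [← hCD, hself, h C.1 C.2, sub_self, mul_zero]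
      · exact horth C D hCD
    refine le_antisymm inf_le_left fun z hz => mem_cycleRadical.2 ⟨hz, fun y hy => ?_⟩
    have h1 : ∀ C, Γ.signForm (c C) z = 0 := by
      intro C
      have hle : Submodule.span ℝ (Set.range c) ≤ LinearMap.ker (Γ.signForm (c C)) := by
        rw [Submodule.span_le]
        rintro _ ⟨D, rfl⟩
        exact hzero C D
      exact hle (hspan hz)
    have hle : Submodule.span ℝ (Set.range c) ≤ LinearMap.ker (Γ.signForm z) := by
      rw [Submodule.span_le]
      rintro _ ⟨C, rfl⟩
      rw [SetLike.mem_coe, LinearMap.mem_ker, signForm_comm]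
      exact h1 C
    rw [signForm_comm]
    exact hle (hspan hy)

/-! ### Signed graphs of nullity `n - 1` -/

theorem isomorphic_iff {Γ₁ : SignedGraph V} {Γ₂ : SignedGraph W} :
    Γ₁.Isomorphic Γ₂ ↔ ∃ f : V ≃ W, ∀ v w, Γ₂.adjMatrix (f v) (f w) = Γ₁.adjMatrix v w := by
  constructor
  · rintro ⟨f, hf⟩
    refine ⟨f.toEquiv, fun v w => ?_⟩
    by_cases h : Γ₁.graph.Adj v w
    · have h' : Γ₂.graph.Adj (f v) (f w) := f.map_adj_iff.2 h
      rw [Γ₁.adjMatrix_of_adj h, ← hf ⟨s(v, w), h⟩]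
      exact Γ₂.adjMatrix_of_adj h'
    · have h' : ¬Γ₂.graph.Adj (f v) (f w) := fun h' => h (f.map_adj_iff.1 h')
      rw [Γ₁.adjMatrix_of_not_adj h]
      exact Γ₂.adjMatrix_of_not_adj h'
  · rintro ⟨f, hf⟩
    refine ⟨⟨f, fun {v w} => ?_⟩, ?_⟩
    · rw [← adjMatrix_ne_zero_iff, ← adjMatrix_ne_zero_iff, hf]
    · rintro ⟨e, he⟩
      induction e with
      | _ v w =>
        have h' : Γ₂.graph.Adj (f v) (f w) := by
          rw [← adjMatrix_ne_zero_iff, hf, adjMatrix_ne_zero_iff]; exact he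
        have h := hf v w
        rw [Γ₂.adjMatrix_of_adj h', Γ₁.adjMatrix_of_adj he] at h
        exact Units.ext (Int.cast_injective h)

theorem adjMatrix_neg (Γ : SignedGraph V) (v w : V) :
    Γ.neg.adjMatrix v w = -Γ.adjMatrix v w := by
  by_cases h : Γ.graph.Adj v w
  · rw [Γ.adjMatrix_of_adj h, Γ.neg.adjMatrix_of_adj h]
    simp [neg]
  · rw [Γ.adjMatrix_of_not_adj h, Γ.neg.adjMatrix_of_not_adj h, neg_zero]

open Classical in
theorem adjMatrix_negJoin_allPosComplete (a b : V ⊕ W) :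
    (negJoin (allPosComplete V) (allPosComplete W)).adjMatrix a b =
      if a = b then 0 else (Sum.elim 1 (-1) a : ℝ) * (Sum.elim 1 (-1) b : ℝ) := by
  rcases a with a | a <;> rcases b with b | b <;>
    simp [adjMatrix, negJoin, allPosComplete, posGraph, signGraph] <;> split_ifs <;> simp

/-- A signed graph whose signs are `± s v * s w`, for a balanced `±1` labelling `s` of the
vertices, has the complete underlying graph and `± (s sᵀ)` as net Laplacian. -/
theorem nullity_add_one_of_labelling [Fintype V] [DecidableEq V] [Nonempty V] (Γ : SignedGraph V)
    {s : V → ℝ} {δ : ℝ} (hδ : δ ≠ 0) (hs : ∀ v, s v * s v = 1) (hsum : ∑ v, s v = 0)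
    (hA : ∀ v w, v ≠ w → Γ.adjMatrix v w = δ * (s v * s w)) :
    Γ.nullity + 1 = Fintype.card V := by
  have hs0 : ∀ v, s v ≠ 0 := fun v h => by simpa [h] using hs v
  let φ : Module.Dual ℝ (V → ℝ) := ∑ v, s v • LinearMap.proj v
  have hφ : ∀ x, φ x = ∑ v, s v * x v := fun x => by simp [φ]
  have hker : LinearMap.ker (Matrix.toLin' Γ.netLaplacian) = LinearMap.ker φ := by
    have happ : ∀ x v, Matrix.toLin' Γ.netLaplacian x v = -(δ * s v) * φ x := by
      intro x v
      have hterm : ∀ w, Γ.signedCoboundary x v w =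
          δ * s v * x v * s w - δ * s v * (s w * x w) := by
        intro w
        rw [signedCoboundary_apply]
        by_cases h : v = w
        · subst h; ring
        · rw [hA v w h]; ring
      rw [toLin'_netLaplacian, hφ]
      change ∑ w, Γ.signedCoboundary x v w = _
      simp only [hterm, Finset.sum_sub_distrib, ← Finset.mul_sum, hsum]
      ring
    ext x
    rw [LinearMap.mem_ker, LinearMap.mem_ker]
    constructor
    · intro h
      obtain ⟨v⟩ := ‹Nonempty V›
      have h1 := happ x v
      rw [h, Pi.zero_apply, zero_eq_mul] at h1
      exact h1.resolve_left (neg_ne_zero.2 (mul_ne_zero hδ (hs0 v)))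
    · intro h
      ext v
      rw [happ, h, mul_zero, Pi.zero_apply]
  have hφ0 : φ ≠ 0 := by
    intro h
    obtain ⟨v⟩ := ‹Nonempty V›
    have h1 := hφ (Pi.single v 1)
    rw [h] at h1
    simp [Pi.single_apply] at h1
    exact hs0 v h1.symm
  rw [nullity, hker, Module.Dual.finrank_ker_add_one_of_ne_zero hφ0,
    Module.finrank_fintype_fun_eq_card]

/-- If the net Laplacian `M` has rank one, then `M i j * M k l = M i l * M k j`. As no row
vanishes, no entry does, so the graph is complete, the off-diagonal entries are `±1`, and the
diagonal entries are integers with pairwise product `1`. Hence any column is a `±1` labelling. -/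
theorem exists_labelling_of_nullity [Fintype V] [DecidableEq V] (Γ : SignedGraph V)
    (hconn : Γ.graph.Connected) (hn : 2 ≤ Fintype.card V) (h : Γ.nullity + 1 = Fintype.card V) :
    ∃ (s : V → ℝ) (δ : ℝ), (δ = 1 ∨ δ = -1) ∧ (∀ v, s v * s v = 1) ∧ ∑ v, s v = 0 ∧
      ∀ v w, v ≠ w → Γ.adjMatrix v w = δ * (s v * s w) := by
  have hrank : Module.finrank ℝ (LinearMap.range (Matrix.toLin' Γ.netLaplacian)) ≤ 1 := by
    have h1 := LinearMap.finrank_range_add_finrank_ker (Matrix.toLin' Γ.netLaplacian)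
    rw [Module.finrank_fintype_fun_eq_card] at h1
    rw [nullity] at h
    omega
  obtain ⟨⟨u, hu⟩, hspan⟩ := finrank_le_one_iff.1 hrank
  obtain ⟨c, hc⟩ : ∃ c : V → ℝ, ∀ i j, Γ.netLaplacian i j = c j * u i := by
    have h1 : ∀ j, ∃ t : ℝ, ∀ i, Γ.netLaplacian i j = t * u i := by
      intro j
      obtain ⟨t, ht⟩ := hspan ⟨_, LinearMap.mem_range_self _ (Pi.single j 1)⟩
      refine ⟨t, fun i => ?_⟩
      have h2 := congrFun (congrArg Subtype.val ht) i
      simpa using h2.symm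
    choose c hc using h1
    exact ⟨c, fun i j => hc j i⟩
  have hoff : ∀ i j, i ≠ j → Γ.netLaplacian i j = -Γ.adjMatrix i j := by
    intro i j hij
    simp [netLaplacian, hij]
  have hloop : ∀ i, Γ.adjMatrix i i = 0 := fun i => Γ.adjMatrix_of_not_adj (Γ.graph.irrefl)
  have hdiag : ∀ i, Γ.netLaplacian i i = Γ.netDegree i := by
    intro i
    simp [netLaplacian, hloop]
  have hsymm : ∀ i j, Γ.netLaplacian j i = Γ.netLaplacian i j := by
    intro i j
    by_cases hij : i = j
    · rw [hij]
    · rw [hoff i j hij, hoff j i (Ne.symm hij), adjMatrix_symm]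
  have hnt : Nontrivial V := Fintype.one_lt_card_iff_nontrivial.1 (by omega)
  have hne : ∀ i, u i ≠ 0 ∧ c i ≠ 0 := by
    intro i
    obtain ⟨j, hij⟩ := hconn.preconnected.exists_adj_of_nontrivial i
    have h1 : Γ.netLaplacian i j ≠ 0 := by
      rw [hoff i j hij.ne]
      exact neg_ne_zero.2 (Γ.adjMatrix_ne_zero_iff.2 hij)
    have h2 : Γ.netLaplacian j i ≠ 0 := by rwa [hsymm]
    rw [hc] at h1 h2
    exact ⟨right_ne_zero_of_mul h1, left_ne_zero_of_mul h2⟩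
  have hsq : ∀ i j, i ≠ j → Γ.netLaplacian i j * Γ.netLaplacian i j = 1 := by
    intro i j hij
    have h1 : Γ.netLaplacian i j ≠ 0 := by
      rw [hc]; exact mul_ne_zero (hne j).2 (hne i).1
    rw [hoff i j hij] at h1 ⊢
    rw [neg_mul_neg]
    exact Γ.adjMatrix_mul_self (Γ.adjMatrix_ne_zero_iff.1 (neg_ne_zero.1 h1))
  obtain ⟨r, t, hrt⟩ := hnt.exists_pair_ne
  have hdr : Γ.netDegree r = 1 ∨ Γ.netDegree r = -1 := by
    apply Int.eq_one_or_neg_one_of_mul_eq_one (v := Γ.netDegree t)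
    have h1 : (Γ.netDegree r : ℝ) * Γ.netDegree t = 1 := by
      rw [← hdiag, ← hdiag, ← hsq r t hrt]
      nth_rewrite 4 [← hsymm]
      simp only [hc]; ring
    exact_mod_cast h1
  have hdr' : (Γ.netDegree r : ℝ) * Γ.netDegree r = 1 := by
    rcases hdr with h1 | h1 <;> simp [h1]
  refine ⟨fun i => Γ.netLaplacian i r, -Γ.netDegree r, ?_, ?_, ?_, ?_⟩
  · rcases hdr with h1 | h1 <;> simp [h1]
  · intro i
    by_cases hi : i = r
    · simp only [hi, hdiag, hdr']
    · exact hsq i r hi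
  · have h1 : Γ.netLaplacian r r + ∑ i ∈ Finset.univ.erase r, Γ.netLaplacian i r = 0 := by
      rw [hdiag, netDegree_eq_sum, ← Finset.add_sum_erase _ _ (Finset.mem_univ r), hloop,
        zero_add, ← Finset.sum_add_distrib]
      refine Finset.sum_eq_zero fun i hi => ?_
      rw [hoff i r (Finset.ne_of_mem_erase hi), adjMatrix_symm, add_neg_cancel]
    rwa [Finset.add_sum_erase _ (fun i => Γ.netLaplacian i r) (Finset.mem_univ r)] at h1
  · intro i j hij
    have h1 : Γ.netLaplacian i j * Γ.netDegree r =
        Γ.netLaplacian i r * Γ.netLaplacian j r := by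
      rw [← hdiag, hsymm r j]
      simp only [hc]; ring
    rw [hoff i j hij] at h1
    linear_combination (-Γ.netDegree r : ℝ) * h1 - Γ.adjMatrix i j * hdr'

theorem exists_equiv_of_labelling [Fintype V] {s : V → ℝ} (hs : ∀ v, s v * s v = 1)
    (hsum : ∑ v, s v = 0) :
    Even (Fintype.card V) ∧
      ∃ f : V ≃ Fin (Fintype.card V / 2) ⊕ Fin (Fintype.card V / 2),
        ∀ v, (Sum.elim 1 (-1) (f v) : ℝ) = s v := by
  classical
  have hs' : ∀ v, ¬s v = 1 → s v = -1 := fun v hv => (mul_self_eq_one_iff.1 (hs v)).resolve_left hv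
  have hterm : ∀ v, s v = (if s v = 1 then 1 else 0) - (if ¬s v = 1 then 1 else 0) := by
    intro v
    by_cases hv : s v = 1
    · simp [hv]
    · rw [if_neg hv, if_pos hv, hs' v hv, zero_sub]
  have hcard : Fintype.card {v // s v = 1} = Fintype.card {v // ¬s v = 1} := by
    rw [Finset.sum_congr rfl fun v _ => hterm v, Finset.sum_sub_distrib, Finset.sum_boole,
      Finset.sum_boole, sub_eq_zero, Nat.cast_inj] at hsum
    rw [Fintype.card_subtype, Fintype.card_subtype, hsum]
  have htot := Fintype.card_congr (Equiv.sumCompl fun v => s v = 1)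
  rw [Fintype.card_sum] at htot
  refine ⟨⟨_, by rw [← htot, ← hcard]⟩, ?_⟩
  have f₁ : {v // s v = 1} ≃ Fin (Fintype.card V / 2) :=
    Fintype.equivFinOfCardEq (by omega)
  have f₂ : {v // ¬s v = 1} ≃ Fin (Fintype.card V / 2) :=
    Fintype.equivFinOfCardEq (by omega)
  refine ⟨(Equiv.sumCompl fun v => s v = 1).symm.trans (f₁.sumCongr f₂), fun v => ?_⟩
  by_cases hv : s v = 1
  · simp [Equiv.sumCompl_symm_apply_of_pos (p := fun v => s v = 1) hv, hv]
  · simp [Equiv.sumCompl_symm_apply_of_neg (p := fun v => s v = 1) hv, hs' v hv]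

theorem nullity_add_one_eq_card_iff [Fintype V] [DecidableEq V] (Γ : SignedGraph V)
    (hconn : Γ.graph.Connected) (hn : 2 ≤ Fintype.card V) :
    Γ.nullity + 1 = Fintype.card V ↔
      Even (Fintype.card V) ∧
        (Γ.Isomorphic (negJoin (allPosComplete (Fin (Fintype.card V / 2)))
            (allPosComplete (Fin (Fintype.card V / 2)))) ∨
          Γ.Isomorphic (negJoin (allPosComplete (Fin (Fintype.card V / 2)))
            (allPosComplete (Fin (Fintype.card V / 2)))).neg) := by
  simp only [isomorphic_iff, adjMatrix_neg, adjMatrix_negJoin_allPosComplete]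
  constructor
  · intro h
    obtain ⟨s, δ, hδ, hs, hsum, hA⟩ := Γ.exists_labelling_of_nullity hconn hn h
    obtain ⟨heven, f, hf⟩ := exists_equiv_of_labelling hs hsum
    refine ⟨heven, hδ.imp (fun h1 => ⟨f, fun v w => ?_⟩) (fun h1 => ⟨f, fun v w => ?_⟩)⟩
    all_goals
      by_cases hvw : v = w
      · simp [hvw, Γ.adjMatrix_of_not_adj Γ.graph.irrefl]
      · rw [if_neg (f.injective.ne hvw), hA v w hvw, hf, hf, h1]; ring
  · rintro ⟨-, h⟩
    have hV := hconn.nonempty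
    have key : ∀ (f : V ≃ Fin (Fintype.card V / 2) ⊕ Fin (Fintype.card V / 2)) (δ : ℝ),
        δ ≠ 0 → (∀ v w, v ≠ w → Γ.adjMatrix v w =
          δ * ((Sum.elim 1 (-1) (f v) : ℝ) * (Sum.elim 1 (-1) (f w) : ℝ))) →
        Γ.nullity + 1 = Fintype.card V := by
      intro f δ hδ hA
      refine Γ.nullity_add_one_of_labelling hδ (s := fun v => Sum.elim 1 (-1) (f v))
        (fun v => ?_) ?_ hA
      · rcases f v with a | a <;> simp
      · rw [f.sum_comp (fun a => (Sum.elim 1 (-1) a : ℝ))]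
        simp
    rcases h with ⟨f, hf⟩ | ⟨f, hf⟩
    · refine key f 1 one_ne_zero fun v w hvw => ?_
      rw [← hf, if_neg (f.injective.ne hvw), one_mul]
    · refine key f (-1) (neg_ne_zero.2 one_ne_zero) fun v w hvw => ?_
      rw [← hf, if_neg (f.injective.ne hvw), neg_one_mul]

theorem nullity_lt_card [Fintype V] [DecidableEq V] (Γ : SignedGraph V)
    (hconn : Γ.graph.Connected) (hn : 2 ≤ Fintype.card V) :
    Γ.nullity < Fintype.card V := by
  have hnt : Nontrivial V := Fintype.one_lt_card_iff_nontrivial.1 (by omega)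
  have hle : Γ.nullity ≤ Fintype.card V := by
    rw [← Module.finrank_fintype_fun_eq_card (R := ℝ)]
    exact Submodule.finrank_le _
  refine lt_of_le_of_ne hle fun heq => ?_
  have htop : LinearMap.ker (Matrix.toLin' Γ.netLaplacian) = ⊤ := by
    apply Submodule.eq_top_of_finrank_eq
    rw [Module.finrank_fintype_fun_eq_card]
    exact heq
  have hL : Γ.netLaplacian = 0 := by
    rw [LinearMap.ker_eq_top] at htop
    exact (Matrix.toLin'.map_eq_zero_iff).1 htop
  obtain ⟨v⟩ := hconn.nonempty
  obtain ⟨w, hvw⟩ := hconn.preconnected.exists_adj_of_nontrivial v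
  have h1 : Γ.netLaplacian v w = -Γ.adjMatrix v w := by simp [netLaplacian, hvw.ne]
  rw [hL, Matrix.zero_apply, zero_eq_neg] at h1
  exact Γ.adjMatrix_ne_zero_iff.2 hvw h1

end SignedGraph

theorem theorem1p2 {V : Type*} [Fintype V] [DecidableEq V] (Γ : SignedGraph V)
    (hconn : Γ.graph.Connected) (hn : 2 ≤ Fintype.card V) :
    (1 ≤ Γ.nullity ∧
      (Γ.nullity : ℤ) ≤ min (Γ.cyclomaticNumber + 1) ((Fintype.card V : ℤ) - 1)) ∧
    ((Γ.nullity : ℤ) = (Fintype.card V : ℤ) - 1 ↔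
      Even (Fintype.card V) ∧
        (Γ.Isomorphic
            (SignedGraph.negJoin (SignedGraph.allPosComplete (Fin (Fintype.card V / 2)))
              (SignedGraph.allPosComplete (Fin (Fintype.card V / 2)))) ∨
          Γ.Isomorphic
            (SignedGraph.negJoin (SignedGraph.allPosComplete (Fin (Fintype.card V / 2)))
              (SignedGraph.allPosComplete (Fin (Fintype.card V / 2)))).neg)) ∧
    (SignedGraph.IsCactus Γ.graph →
      (Γ.nullity = 1 ↔
        ∀ C : Γ.graph.Subgraph, SignedGraph.IsCycle C → Γ.numPos C ≠ Γ.numNeg C) ∧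
      ((Γ.nullity : ℤ) = Γ.cyclomaticNumber + 1 ↔
        ∀ C : Γ.graph.Subgraph, SignedGraph.IsCycle C → Γ.numPos C = Γ.numNeg C)) := by
  have hnull := Γ.nullity_eq_finrank_cycleRadical_add_one hconn
  have hβ := Γ.cyclomaticNumber_eq_finrank hconn
  have hle : Γ.cycleRadical ≤ Γ.graph.cycleSpace := inf_le_left
  have hfin := Submodule.finrank_mono hle
  have hlt := Γ.nullity_lt_card hconn hn
  refine ⟨⟨by omega, le_min (by omega) (by omega)⟩, ?_, fun hcactus => ⟨?_, ?_⟩⟩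
  · rw [← Γ.nullity_add_one_eq_card_iff hconn hn]
    omega
  · rw [← Γ.cycleRadical_eq_bot_iff hcactus, ← Submodule.finrank_eq_zero (R := ℝ)]
    omega
  · rw [← Γ.cycleRadical_eq_cycleSpace_iff hcactus]
    constructor
    · intro h
      exact Submodule.eq_of_le_of_finrank_eq hle (by omega)
    · intro h
      rw [hβ, hnull, h]
      push_cast
      rfl
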